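/- Let $V$ be a finite set. A \emph{stochastic diffusion model} (SDM) $\mathcal{G}(V,H)$ consists of a probability distribution over families $\boldsymbol\phi=(\phi_v)_{v\in V}$ of monotone activation functions $\phi_v:2^{V\setminus\{v\}}\to\{0,1\}$, together with a utility function $H:2^V\to\mathbb{R}_{\ge 0}$ that is monotone with $H(\emptyset)=0$. For a seed set $S\subseteq V$ let $R^0(\boldsymbol\phi,S)=S$ and $R^{t+1}(\boldsymbol\phi,S)=R^t(\boldsymbol\phi,S)\cup\{v\notin R^t(\boldsymbol\phi,S) : \phi_v(R^t(\boldsymbol\phi,S))=1\}$; the $\tau$-step influence of $S$ is $I^\tau(S)=\mathbb{E}_{\boldsymbol\phi}[H(R^\tau(\boldsymbol\phi,S))]$. The SDM is \emph{independent} if the random functions $\phi_v$, $v\in V$, are independent. A set function $F$ is \emph{submodular} if $F(A\cup B)+F(A\cap B)\le F(A)+F(B)$ for all $A,B$. Let $T\subseteq V$ be such that $\Pr[\phi_v(T)=0]>0$ for every $v\in V\setminus T$. The \emph{reduced model} of $\mathcal{G}$ with respect to $T$ is the SDM on the node set $V\setminus T$ whose activation functions $\phi'_v$, $v\in V\setminus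 T$, are independent, $\phi'_v$ being distributed as $S\mapsto\phi_v(S\cup T)$ (for $S\subseteq V\setminus(T\cup\{v\})$) where $\phi_v$ is drawn from $\mathcal{G}$ conditioned on $\phi_v(T)=0$, and whose utility is $H'(S)=H(S\cup T)-H(T)$. An SDM is \emph{strongly submodular} if it is independent, $H$ is submodular, and for each of its reduced models and each step limit $\tau\ge 0$ the $\tau$-step influence function of the reduced model is submodular. \textbf{Theorem.} Let $H$ be a submodular utility function on $V$. (a) (Independent Cascade.) Let $\mathcal{E}\subseteq V\times V$ be a set of directed edges and $p_e\in[0,1]$ for $e\in\mathcal{E}$. Let each edge $e$ be live independently with probability $p_e$, and let $\phi_v(S)=1$ if and only if there is a live edge from a node of $S$ to $v$. Then the resulting SDM with utility $H$ is strongly submodular. (b) (Independent generalized threshold.) Let $f_v:2^V\to[0,1]$, $v\in V$, be monotone and submodular, let $\theta_v$, $v\in V$, be independent and uniform on $[0,1]$, and let $\phi_v(S)=1$ if and only if $\theta_v\le f_v(S)$. Then the resulting SDM with utility $H$ is strongly submodular. -/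

import Mathlib

open MeasureTheory ProbabilityTheory

/-- A real set function is submodular. -/
def IsSubmodular {V : Type*} [DecidableEq V] (F : Finset V → ℝ) : Prop :=
  ∀ A B : Finset V, F (A ∪ B) + F (A ∩ B) ≤ F A + F B

/-- Activation functions of the node `v`: monotone boolean functions on the subsets of
`V \ {v}`. -/
abbrev ActFn (V : Type*) (v : V) := {S : Finset V // v ∉ S} →o Bool

/-- There are finitely many activation functions; every set of them is an event. -/
instance ActFn.instMeasurableSpace {V : Type*} (v : V) : MeasurableSpace (ActFn V v) := ⊤

instance ActFn.instDiscrete {V : Type*} (v : V) : DiscreteMeasurableSpace (ActFn V v) :=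
  ⟨fun _ => trivial⟩

instance ActFn.instFinite {V : Type*} [Fintype V] (v : V) : Finite (ActFn V v) :=
  DFunLike.finite _

/-- One step of the diffusion: active nodes stay active, and an inactive node becomes active
when its activation function is `1` on the current set of active nodes. -/
def diffusionStep {V : Type*} [Fintype V] [DecidableEq V] (φ : ∀ v, ActFn V v)
    (S : Finset V) : Finset V :=
  Finset.univ.filter fun v => if h : v ∈ S then True else φ v ⟨S, h⟩ = true

/-- The `t`-steps reachability set of the seed set `S`. -/
def reach {V : Type*} [Fintype V] [DecidableEq V] (φ : ∀ v, ActFn V v) :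
    ℕ → Finset V → Finset V
  | 0, S => S
  | t + 1, S => diffusionStep φ (reach φ t S)

/-- Utility functions: nonnegative, monotone, zero at the empty set. -/
structure Utility (V : Type*) where
  toFun : Finset V → ℝ
  nonneg : ∀ S, 0 ≤ toFun S
  mono : Monotone toFun
  map_empty : toFun ∅ = 0

/-- A stochastic diffusion model with a utility function: a probability distribution over
families of activation functions, one for each node, and a utility. -/
structure SDM (V : Type*) where
  law : Measure (∀ v, ActFn V v)
  isProb : IsProbabilityMeasure law
  utility : Utility V

namespace SDM

/-- The `τ`-steps influence: the expected utility of the `τ`-steps reachability set. -/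
noncomputable def influence {V : Type*} [Fintype V] [DecidableEq V] (G : SDM V) (τ : ℕ)
    (S : Finset V) : ℝ :=
  ∫ φ, G.utility.toFun (reach φ τ S) ∂G.law

/-- The activation functions of different nodes are independent random variables. -/
def Independent {V : Type*} (G : SDM V) : Prop :=
  iIndepFun (fun (v : V) (φ : ∀ v, ActFn V v) => φ v) G.law

/-- The distribution of the activation function of the node `v`. -/
noncomputable def nodeLaw {V : Type*} (G : SDM V) (v : V) : Measure (ActFn V v) :=
  G.law.map fun φ => φ v

end SDM

/-- The subset `S ∪ T` of `V`, for a set `S` of nodes of `V \ T`. -/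
def liftUnion {V : Type*} [DecidableEq V] (T : Finset V) (S : Finset {v : V // v ∉ T}) :
    Finset V :=
  S.map (Function.Embedding.subtype _) ∪ T

theorem notMem_liftUnion {V : Type*} [DecidableEq V] {T : Finset V}
    {v : {v : V // v ∉ T}} {S : Finset {v : V // v ∉ T}} (h : v ∉ S) :
    v.1 ∉ liftUnion T S := by
  simp [liftUnion, v.2, h]

theorem liftUnion_mono {V : Type*} [DecidableEq V] (T : Finset V) :
    Monotone (liftUnion T) := fun _ _ h =>
  Finset.union_subset_union (Finset.map_subset_map.2 h) le_rfl

/-- The activation function `S ↦ g (S ∪ T)` of the node `v ∉ T` over the nodes `V \ T`. -/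
def ActFn.reduce {V : Type*} [DecidableEq V] (T : Finset V) (v : {v : V // v ∉ T})
    (g : ActFn V v.1) : ActFn {v : V // v ∉ T} v where
  toFun S := g ⟨liftUnion T S.1, notMem_liftUnion S.2⟩
  monotone' _ _ h := g.monotone' (liftUnion_mono T h)

/-- The marginal utility `S ↦ H (S ∪ T) - H T` over the nodes `V \ T`. -/
def Utility.reduce {V : Type*} [DecidableEq V] (H : Utility V) (T : Finset V) :
    Utility {v : V // v ∉ T} where
  toFun S := H.toFun (liftUnion T S) - H.toFun T
  nonneg _ := sub_nonneg.2 (H.mono Finset.subset_union_right)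
  mono _ _ h := sub_le_sub_right (H.mono (liftUnion_mono T h)) _
  map_empty := by simp [liftUnion]

namespace SDM

/-- The distribution of the reduced activation function of `v ∉ T`: draw the activation function
`g` of `v` in `G` conditioned on `g T = 0`, and take `S ↦ g (S ∪ T)`. -/
noncomputable def reducedNodeLaw {V : Type*} [DecidableEq V] (G : SDM V) (T : Finset V)
    (v : {v : V // v ∉ T}) : Measure (ActFn {v : V // v ∉ T} v) :=
  (cond (G.nodeLaw v.1) {g | g ⟨T, v.2⟩ = false}).map (ActFn.reduce T v)

/-- The events on which the reduction with respect to `T` conditions have positive probability. -/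
def Reducible {V : Type*} (G : SDM V) (T : Finset V) : Prop :=
  ∀ v : {v : V // v ∉ T}, G.nodeLaw v.1 {g | g ⟨T, v.2⟩ = false} ≠ 0

theorem reducedNodeLaw_isProb {V : Type*} [DecidableEq V] (G : SDM V)
    (T : Finset V) (hT : G.Reducible T) (v : {v : V // v ∉ T}) :
    IsProbabilityMeasure (G.reducedNodeLaw T v) := by
  have := G.isProb
  have : IsProbabilityMeasure (G.nodeLaw v.1) :=
    Measure.isProbabilityMeasure_map (measurable_pi_apply v.1).aemeasurable
  have := cond_isProbabilityMeasure (hT v)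
  exact Measure.isProbabilityMeasure_map Measurable.of_discrete.aemeasurable

/-- The reduced model of `G` with respect to `T`: its nodes are `V \ T`, their activation
functions are drawn independently from the conditioned distributions, and its utility is the
marginal utility with respect to `T`. -/
noncomputable def reduced {V : Type*} [Fintype V] [DecidableEq V] (G : SDM V) (T : Finset V)
    (hT : G.Reducible T) : SDM {v : V // v ∉ T} where
  law := Measure.pi (G.reducedNodeLaw T)
  isProb := by
    have := G.reducedNodeLaw_isProb T hT
    infer_instance
  utility := G.utility.reduce T

/-- Strongly submodular SDMs: independent, with submodular utility, and the `τ`-steps influence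
function of every reduced model is submodular, for every step limit `τ`. -/
def StronglySubmodular {V : Type*} [Fintype V] [DecidableEq V] (G : SDM V) : Prop :=
  G.Independent ∧ IsSubmodular G.utility.toFun ∧
    ∀ (T : Finset V) (hT : G.Reducible T) (τ : ℕ),
      IsSubmodular ((G.reduced T hT).influence τ)

end SDM

/-- The activation functions given by a set of live edges (`ω e = true`) of a directed graph
with edge set `E`: `v` is activated by `S` iff there is a live edge from a node of `S` to `v`. -/
def liveEdgeAct {V : Type*} [DecidableEq V] (E : Finset (V × V)) (ω : E → Bool) (v : V) :
    ActFn V v where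
  toFun S := decide (∃ e : E, e.1.1 ∈ S.1 ∧ e.1.2 = v ∧ ω e = true)
  monotone' S S' h := by
    rw [Bool.le_iff_imp]
    simp only [decide_eq_true_eq]
    rintro ⟨e, h1, h2⟩
    exact ⟨e, h h1, h2⟩

/-- The live-edge model with edge set `E` whose live edges are distributed by `P`. -/
noncomputable def SDM.liveEdge {V : Type*} [DecidableEq V] (E : Finset (V × V))
    (P : Measure (E → Bool)) [IsProbabilityMeasure P] (H : Utility V) : SDM V where
  law := P.map (liveEdgeAct E)
  isProb := Measure.isProbabilityMeasure_map Measurable.of_discrete.aemeasurable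
  utility := H

/-- The Independent Cascade model: the edges `e` of a directed graph are independently live, with
probabilities `p e`. -/
noncomputable def SDM.independentCascade {V : Type*} [DecidableEq V]
    (E : Finset (V × V)) (p : E → unitInterval) (H : Utility V) : SDM V :=
  SDM.liveEdge E (Measure.pi fun e => bernoulliMeasure true false (p e)) H

/-- A family of monotone functions `f v : 2^V → [0,1]`, one for each node `v`. -/
structure ThresholdFamily (V : Type*) where
  f : V → Finset V → ℝ
  mem_Icc : ∀ v S, f v S ∈ Set.Icc (0 : ℝ) 1
  mono : ∀ v, Monotone (f v)

/-- The activation functions given by threshold values `θ`: `v` is activated by `S` iff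
`θ v ≤ f v S`. -/
noncomputable def thresholdAct {V : Type*} (F : ThresholdFamily V) (θ : V → unitInterval)
    (v : V) : ActFn V v where
  toFun S := decide ((θ v : ℝ) ≤ F.f v S.1)
  monotone' S S' h := by
    rw [Bool.le_iff_imp]
    simp only [decide_eq_true_eq]
    exact fun h1 => h1.trans (F.mono v h)

theorem measurable_thresholdAct {V : Type*} [Fintype V] (F : ThresholdFamily V) :
    Measurable (thresholdAct F) := by
  refine measurable_pi_iff.2 fun v => measurable_to_countable' fun g => ?_
  have : (fun θ => thresholdAct F θ v) ⁻¹' {g} =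
      ⋂ S : {S : Finset V // v ∉ S},
        {θ : V → unitInterval | (θ v : ℝ) ≤ F.f v S.1 ↔ g S = true} := by
    ext θ
    simp only [Set.mem_preimage, Set.mem_singleton_iff, Set.mem_iInter, OrderHom.ext_iff,
      funext_iff]
    refine forall_congr' fun S => ?_
    change decide ((θ v : ℝ) ≤ F.f v S.1) = g S ↔ _
    rw [Bool.eq_iff_iff, decide_eq_true_eq]
    rfl
  rw [this]
  refine MeasurableSet.iInter fun S => ?_
  have hm : MeasurableSet {θ : V → unitInterval | (θ v : ℝ) ≤ F.f v S.1} :=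
    measurableSet_le (measurable_subtype_coe.comp (measurable_pi_apply v)) measurable_const
  by_cases h : g S = true
  · simpa [h] using hm
  · have hc := hm.compl
    simp only [Set.compl_ofPred] at hc
    simpa only [h, iff_false, Bool.false_eq_true] using hc

/-- The generalized threshold model with functions `F` whose threshold values are distributed
by `P`. -/
noncomputable def SDM.generalizedThreshold {V : Type*} [Fintype V] (F : ThresholdFamily V)
    (P : Measure (V → unitInterval)) [IsProbabilityMeasure P] (H : Utility V) : SDM V where
  law := P.map (thresholdAct F)
  isProb := Measure.isProbabilityMeasure_map (measurable_thresholdAct F).aemeasurable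
  utility := H

/-- The generalized threshold model whose threshold values are independent and uniformly
distributed on `[0,1]`. -/
noncomputable def SDM.independentThreshold {V : Type*} [Fintype V] (F : ThresholdFamily V)
    (H : Utility V) : SDM V :=
  SDM.generalizedThreshold F (Measure.pi fun _ => (volume : Measure unitInterval)) H

/-!
The influence of a seed set depends on the law of each activation function only through the
activation probabilities of its node along increasing chains of active sets.  Both parts are
therefore instances of one fact, `SDM.stronglySubmodular_of_nodeLaw`: an independent model with a
monotone submodular utility is strongly submodular as soon as, for every node `v`, the probability
that `S` activates `v` is a submodular function of `S`.  This hypothesis passes to reduced models,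
where conditioning rescales the activation probabilities affinely, so it is enough to show that the
`n`-step influence is submodular (`influenceSubmodular`).

This is an induction on `n`.  The sets active after the first step are random, and they are
correlated with the rest of the process, since each node keeps its activation function.  To
separate the two roles of the seeds, `triggeredInfluence H n μ x S` seeds, besides `S`, every node
`v` whose activation function lies in a given set `x v`; for `x v = activates v S` this is the
`(n + 1)`-step influence of `S`.  As long as `x v ⊆ activates v S`, it is affine in the probability
of each `x v` (`triggeredInfluence_eq_add`): a node triggered by `x v` would be active one step
later anyway, so its activation function may be replaced by the constant `1`.  The slope
`forcedGain` is thus the gain from seeding `v` in an `n`-step model in which `v` is always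
activated.  By the induction hypothesis it decreases in the seeds, and consequently, by affinity in
the other coordinates, in the triggering probabilities (`forcedGain_anti_seeds`,
`forcedGain_anti_trigger`).  For fixed `x`, conditioning on the triggered set shows that
`triggeredInfluence` is submodular in the seeds (`InfluenceSubmodular.triggeredInfluence`).  The
submodularity inequality for `n + 1` steps is the sum of three inequalities of these kinds.
-/

/-! ### Activation by a set of active nodes -/

section Activation

variable {V : Type*}

/-- The activation functions of `v` under which `v` is active one step after the active set is
`S`.  If `v` already belongs to `S`, these are all activation functions. -/
def activates (v : V) (S : Finset V) : Set (ActFn V v) :=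
  {g | ∀ h : v ∉ S, g ⟨S, h⟩ = true}

theorem activates_mono (v : V) {S T : Finset V} (hST : S ⊆ T) :
    activates v S ⊆ activates v T := fun g hg h => by
  have h' := hg fun hv => h (hST hv)
  have hle : g ⟨S, fun hv => h (hST hv)⟩ ≤ g ⟨T, h⟩ := g.monotone' hST
  rw [h'] at hle
  exact top_le_iff.1 hle

theorem top_mem_activates (v : V) (S : Finset V) : (⊤ : ActFn V v) ∈ activates v S :=
  fun _ => rfl

theorem mem_diffusionStep [Fintype V] [DecidableEq V] {φ : ∀ v, ActFn V v} {S : Finset V} {v : V} :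
    v ∈ diffusionStep φ S ↔ φ v ∈ activates v S := by
  by_cases h : v ∈ S <;> simp [diffusionStep, activates, h]

theorem subset_diffusionStep [Fintype V] [DecidableEq V] (φ : ∀ v, ActFn V v) (S : Finset V) :
    S ⊆ diffusionStep φ S := fun _ hv => mem_diffusionStep.2 fun h => absurd hv h

theorem diffusionStep_mono [Fintype V] [DecidableEq V] (φ : ∀ v, ActFn V v) :
    Monotone (diffusionStep φ) := fun _ _ h _ hv =>
  mem_diffusionStep.2 (activates_mono _ h (mem_diffusionStep.1 hv))

theorem reach_succ_eq_reach_diffusionStep [Fintype V] [DecidableEq V] (φ : ∀ v, ActFn V v)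
    (n : ℕ) (S : Finset V) : reach φ (n + 1) S = reach φ n (diffusionStep φ S) := by
  induction n with
  | zero => rfl
  | succ n ih => exact congrArg (diffusionStep φ) ih

theorem reach_mono [Fintype V] [DecidableEq V] (φ : ∀ v, ActFn V v) (n : ℕ) :
    Monotone (reach φ n) := by
  induction n with
  | zero => exact monotone_id
  | succ n ih => exact (diffusionStep_mono φ).comp ih

/-- A node that is bound to be active after the first step can be given the activation function
which is constantly `1`. -/
theorem reach_update_top [Fintype V] [DecidableEq V] (φ : ∀ v, ActFn V v) {v : V}
    {S T : Finset V} (hv : φ v ∈ activates v S) (hST : S ⊆ T) (n : ℕ) :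
    reach (Function.update φ v ⊤) n T = reach φ n T := by
  induction n generalizing T with
  | zero => rfl
  | succ n ih =>
    have hstep : diffusionStep (Function.update φ v ⊤) T = diffusionStep φ T := by
      ext u
      rw [mem_diffusionStep, mem_diffusionStep]
      rcases eq_or_ne u v with rfl | hu
      · rw [Function.update_self]
        exact iff_of_true (top_mem_activates u T) (activates_mono u hST hv)
      · rw [Function.update_of_ne hu]
    rw [reach_succ_eq_reach_diffusionStep, reach_succ_eq_reach_diffusionStep, hstep,
      ih (hST.trans (subset_diffusionStep φ T))]

end Activation

/-! ### Product measures and conditioning -/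

section ProductMeasure

variable {ι : Type*} [Fintype ι] [DecidableEq ι] {α : ι → Type*} [∀ i, MeasurableSpace (α i)]

/-- Resampling the coordinate `v` of a product measure from `ν` gives the product measure with
`ν` as its marginal at `v`. -/
theorem map_update_pi_prod (μ : ∀ i, ProbabilityMeasure (α i)) (v : ι)
    (ν : ProbabilityMeasure (α v)) :
    ((Measure.pi fun i => (μ i : Measure (α i))).prod (ν : Measure (α v))).map
        (fun p => Function.update p.1 v p.2) =
      Measure.pi fun i => (Function.update μ v ν i : Measure (α i)) := by
  have hm : Measurable fun p : (∀ i, α i) × α v => Function.update p.1 v p.2 := by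
    refine measurable_pi_iff.2 fun i => ?_
    rcases eq_or_ne i v with rfl | hi
    · simpa using measurable_snd
    · simp only [Function.update_of_ne hi]
      exact (measurable_pi_apply i).comp measurable_fst
  refine (Measure.pi_eq fun s hs => ?_).symm
  rw [Measure.map_apply hm (MeasurableSet.univ_pi hs)]
  have hpre : (fun p : (∀ i, α i) × α v => Function.update p.1 v p.2) ⁻¹' Set.univ.pi s =
      (Set.univ.pi (Function.update s v Set.univ)) ×ˢ s v := by
    ext p
    simp only [Set.mem_preimage, Set.mem_univ_pi, Set.mem_prod]
    constructor
    · intro h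
      refine ⟨fun i => ?_, by simpa using h v⟩
      rcases eq_or_ne i v with rfl | hi
      · simp
      · simpa [Function.update_of_ne hi] using h i
    · rintro ⟨h1, h2⟩ i
      rcases eq_or_ne i v with rfl | hi
      · simpa using h2
      · simpa [Function.update_of_ne hi] using h1 i
  rw [hpre, Measure.prod_prod, Measure.pi_pi,
    ← Finset.mul_prod_erase _ _ (Finset.mem_univ v),
    ← Finset.mul_prod_erase _ (fun i => (Function.update μ v ν i : Measure (α i)) (s i))
      (Finset.mem_univ v)]
  simp only [Function.update_self, measure_univ, one_mul]
  rw [mul_comm]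
  congr 1
  refine Finset.prod_congr rfl fun i hi => ?_
  rw [Function.update_of_ne (Finset.ne_of_mem_erase hi),
    Function.update_of_ne (Finset.ne_of_mem_erase hi)]

variable [∀ i, Finite (α i)] [∀ i, DiscreteMeasurableSpace (α i)]

theorem integral_pi_update (μ : ∀ i, ProbabilityMeasure (α i)) (v : ι)
    (ν : ProbabilityMeasure (α v)) (G : (∀ i, α i) → ℝ) :
    ∫ φ, G φ ∂(Measure.pi fun i => (Function.update μ v ν i : Measure (α i))) =
      ∫ φ, ∫ s, G (Function.update φ v s) ∂(ν : Measure (α v))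
        ∂(Measure.pi fun i => (μ i : Measure (α i))) := by
  rw [← map_update_pi_prod, integral_map Measurable.of_discrete.aemeasurable
    (Measurable.of_discrete).aestronglyMeasurable, integral_prod _ Integrable.of_finite]

theorem integral_pi_eq_integral_update (μ : ∀ i, ProbabilityMeasure (α i)) (v : ι)
    (G : (∀ i, α i) → ℝ) :
    ∫ φ, G φ ∂(Measure.pi fun i => (μ i : Measure (α i))) =
      ∫ φ, ∫ s, G (Function.update φ v s) ∂(μ v : Measure (α v))
        ∂(Measure.pi fun i => (μ i : Measure (α i))) := by
  have h := integral_pi_update μ v (μ v) G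
  rwa [Function.update_eq_self] at h

end ProductMeasure

/-- Conditioning on the complement of `A` rescales affinely the probabilities of the events that
contain `A`. -/
theorem cond_compl_real_of_subset {α : Type*} [MeasurableSpace α] [DiscreteMeasurableSpace α]
    (ν : Measure α) [IsProbabilityMeasure ν] {A B : Set α} (hAB : A ⊆ B) :
    (cond ν Aᶜ).real B = (ν.real Aᶜ)⁻¹ * (ν.real B - ν.real A) := by
  have h : Aᶜ ∩ B = B \ A := by
    ext; simp [and_comm]
  rw [measureReal_def, cond_apply MeasurableSet.of_discrete, h, ENNReal.toReal_mul,
    ENNReal.toReal_inv, ← measureReal_def, ← measureReal_def,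
    measureReal_sdiff hAB MeasurableSet.of_discrete]

/-! ### Triggered influence and forced gains -/

section Influence

variable {V : Type*}

/-- Independent activation functions: one probability distribution for each node. -/
abbrev NodeLaws (V : Type*) := ∀ v : V, ProbabilityMeasure (ActFn V v)

/-- The joint distribution of independent activation functions. -/
noncomputable abbrev NodeLaws.joint [Fintype V] (μ : NodeLaws V) : Measure (∀ v, ActFn V v) :=
  Measure.pi fun v => (μ v : Measure (ActFn V v))

/-- The distribution of the activation function which is constantly `1`. -/
noncomputable def diracTop (v : V) : ProbabilityMeasure (ActFn V v) :=
  (⟨Measure.dirac ⊤, inferInstance⟩ : {ν : Measure (ActFn V v) // IsProbabilityMeasure ν})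

theorem coe_diracTop (v : V) : (diracTop v : Measure (ActFn V v)) = Measure.dirac ⊤ := rfl

open Classical in
/-- The nodes whose activation functions lie in the given sets. -/
noncomputable def triggered [Fintype V] (x : ∀ v, Set (ActFn V v)) (φ : ∀ v, ActFn V v) :
    Finset V :=
  Finset.univ.filter fun v => φ v ∈ x v

theorem mem_triggered [Fintype V] {x : ∀ v, Set (ActFn V v)} {φ : ∀ v, ActFn V v} {v : V} :
    v ∈ triggered x φ ↔ φ v ∈ x v := by
  simp [triggered]

variable [DecidableEq V]

/-- The distributions in which the activation function of the node `v` is replaced by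
the constant `1`. -/
noncomputable def NodeLaws.force (μ : NodeLaws V) (v : V) : NodeLaws V :=
  Function.update μ v (diracTop v)

/-- A real set function is submodular on the sets that contain `S₀`. -/
def SubmodularAbove (S₀ : Finset V) (F : Finset V → ℝ) : Prop :=
  ∀ A B : Finset V, S₀ ⊆ A → S₀ ⊆ B → F (A ∪ B) + F (A ∩ B) ≤ F A + F B

/-- For each node, the activation probability is submodular on the sets that contain `S₀`. -/
def NodeLaws.SubmodularAbove (μ : NodeLaws V) (S₀ : Finset V) : Prop :=
  ∀ v, _root_.SubmodularAbove S₀ fun S => (μ v : Measure (ActFn V v)).real (activates v S)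

theorem NodeLaws.SubmodularAbove.mono {μ : NodeLaws V} {S₀ S₁ : Finset V}
    (h : μ.SubmodularAbove S₀) (h' : S₀ ⊆ S₁) : μ.SubmodularAbove S₁ := fun v A B hA hB =>
  h v A B (h'.trans hA) (h'.trans hB)

theorem NodeLaws.SubmodularAbove.update {μ : NodeLaws V} {S₀ : Finset V}
    (h : μ.SubmodularAbove S₀) (v : V) (ν : ProbabilityMeasure (ActFn V v))
    (hν : _root_.SubmodularAbove S₀ fun S => (ν : Measure (ActFn V v)).real (activates v S)) :
    NodeLaws.SubmodularAbove (Function.update μ v ν) S₀ := fun u => by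
  rcases eq_or_ne u v with rfl | hu
  · simpa using hν
  · simpa [Function.update_of_ne hu] using h u

theorem submodularAbove_diracTop (v : V) (S₀ : Finset V) :
    SubmodularAbove S₀ fun S => (diracTop v : Measure (ActFn V v)).real (activates v S) := by
  intro A B _ _
  have h : ∀ S, (diracTop v : Measure (ActFn V v)).real (activates v S) = 1 := fun S => by
    rw [measureReal_def, coe_diracTop, Measure.dirac_apply_of_mem (top_mem_activates v S),
      ENNReal.toReal_one]
  simp only [h, le_refl]

theorem NodeLaws.SubmodularAbove.force {μ : NodeLaws V} {S₀ : Finset V}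
    (h : μ.SubmodularAbove S₀) (v : V) : (μ.force v).SubmodularAbove S₀ :=
  h.update v _ (submodularAbove_diracTop v S₀)

theorem NodeLaws.force_of_ne (μ : NodeLaws V) {u v : V} (h : u ≠ v) : μ.force v u = μ u :=
  Function.update_of_ne h _ _

variable [Fintype V]

theorem triggered_update_of_notMem {x : ∀ v, Set (ActFn V v)} {φ : ∀ v, ActFn V v} {v : V}
    {s : ActFn V v} (hs : s ∉ x v) :
    triggered x (Function.update φ v s) = triggered (Function.update x v ∅) φ := by
  ext u
  rw [mem_triggered, mem_triggered]
  rcases eq_or_ne u v with rfl | hu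
  · simpa using hs
  · simp [Function.update_of_ne hu]

theorem triggered_update_of_mem {x : ∀ v, Set (ActFn V v)} {φ : ∀ v, ActFn V v} {v : V}
    {s : ActFn V v} (hs : s ∈ x v) :
    triggered x (Function.update φ v s) =
      insert v (triggered (Function.update x v ∅) φ) := by
  ext u
  rw [Finset.mem_insert, mem_triggered, mem_triggered]
  rcases eq_or_ne u v with rfl | hu
  · simpa using hs
  · simp [hu]

/-- The expected value of `H` at the set reached in `n` steps from the seeds `S` and the triggered
nodes of `x`.  The same activation functions decide which nodes are triggered and drive the
diffusion; with `x v = activates v S` this is the influence of `S` in `n + 1` steps, and with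
`x v = ∅` it is the influence of `S` in `n` steps. -/
noncomputable def triggeredInfluence (H : Finset V → ℝ) (n : ℕ) (μ : NodeLaws V)
    (x : ∀ v, Set (ActFn V v)) (S : Finset V) : ℝ :=
  ∫ φ, H (reach φ n (S ∪ triggered x φ)) ∂μ.joint

theorem triggeredInfluence_empty (H : Finset V → ℝ) (n : ℕ) (μ : NodeLaws V) (S : Finset V) :
    triggeredInfluence H n μ (fun _ => ∅) S = ∫ φ, H (reach φ n S) ∂μ.joint := by
  have h : ∀ φ : ∀ v, ActFn V v, triggered (fun _ => ∅) φ = ∅ := fun φ => by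
    ext; simp [mem_triggered]
  simp [triggeredInfluence, h]

theorem triggeredInfluence_activates (H : Finset V → ℝ) (n : ℕ) (μ : NodeLaws V)
    (S : Finset V) :
    triggeredInfluence H n μ (fun v => activates v S) S =
      triggeredInfluence H (n + 1) μ (fun _ => ∅) S := by
  rw [triggeredInfluence_empty]
  refine integral_congr_ae (.of_forall fun φ => ?_)
  have h : S ∪ triggered (fun v => activates v S) φ = diffusionStep φ S := by
    ext v
    rw [Finset.mem_union, mem_triggered, ← mem_diffusionStep]
    exact or_iff_right_of_imp fun hv => subset_diffusionStep φ S hv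
  simp only [h, reach_succ_eq_reach_diffusionStep]

theorem triggeredInfluence_mono {H : Finset V → ℝ} (hH : Monotone H) (n : ℕ) (μ : NodeLaws V)
    (x : ∀ v, Set (ActFn V v)) : Monotone (triggeredInfluence H n μ x) := fun _ _ h =>
  integral_mono Integrable.of_finite Integrable.of_finite fun φ =>
    hH (reach_mono φ n (Finset.union_subset_union_left h))

/-- The expected gain from activating `v` together with the seeds, compared with its activation
one step later.  This is the slope of `triggeredInfluence` in the probability of `x v`. -/
noncomputable def forcedGain (H : Finset V → ℝ) (n : ℕ) (μ : NodeLaws V)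
    (x : ∀ v, Set (ActFn V v)) (v : V) (S : Finset V) : ℝ :=
  triggeredInfluence H n (μ.force v) (Function.update x v ∅) (insert v S) -
    triggeredInfluence H n (μ.force v) (Function.update x v ∅) S

theorem forcedGain_nonneg {H : Finset V → ℝ} (hH : Monotone H) (n : ℕ) (μ : NodeLaws V)
    (x : ∀ v, Set (ActFn V v)) (v : V) (S : Finset V) : 0 ≤ forcedGain H n μ x v S :=
  sub_nonneg.2 (triggeredInfluence_mono hH n _ _ (Finset.subset_insert v S))

theorem forcedGain_update (H : Finset V → ℝ) (n : ℕ) (μ : NodeLaws V)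
    (x : ∀ v, Set (ActFn V v)) (v : V) (y : Set (ActFn V v)) (S : Finset V) :
    forcedGain H n μ (Function.update x v y) v S = forcedGain H n μ x v S := by
  simp [forcedGain, Function.update_idem]

/-- Under `μ.force v`, triggered influence integrates over the other activation functions only. -/
theorem triggeredInfluence_force (H : Finset V → ℝ) (n : ℕ) (μ : NodeLaws V)
    (x : ∀ v, Set (ActFn V v)) (v : V) (S : Finset V) :
    triggeredInfluence H n (μ.force v) (Function.update x v ∅) S =
      ∫ φ, H (reach (Function.update φ v ⊤) n (S ∪ triggered (Function.update x v ∅) φ))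
        ∂μ.joint := by
  rw [triggeredInfluence, NodeLaws.force, NodeLaws.joint, integral_pi_update]
  refine integral_congr_ae (.of_forall fun φ => ?_)
  have h := triggered_update_of_notMem (x := Function.update x v ∅) (φ := φ) (v := v) (s := ⊤)
    (by simp)
  rw [Function.update_idem] at h
  beta_reduce
  rw [coe_diracTop, integral_dirac, h]

/-- Triggered influence is affine in the probability that `v` is triggered, as long as only
activation functions that activate `v` in the first step anyway are concerned. -/
theorem triggeredInfluence_eq_add (H : Finset V → ℝ) (n : ℕ) (μ : NodeLaws V)
    (x : ∀ v, Set (ActFn V v)) (v : V) (S : Finset V) (hx : x v ⊆ activates v S) :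
    triggeredInfluence H n μ x S = triggeredInfluence H n μ (Function.update x v ∅) S +
      (μ v : Measure (ActFn V v)).real (x v) * forcedGain H n μ x v S := by
  rw [forcedGain, triggeredInfluence_force, triggeredInfluence_force,
    ← integral_sub Integrable.of_finite Integrable.of_finite, ← integral_const_mul,
    ← sub_eq_iff_eq_add', triggeredInfluence, triggeredInfluence,
    ← integral_sub Integrable.of_finite Integrable.of_finite,
    NodeLaws.joint, integral_pi_eq_integral_update μ v]
  refine integral_congr_ae (.of_forall fun φ => ?_)
  -- For fixed other activation functions, the integrands differ by the constant `d` on `x v`.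
  set X := triggered (Function.update x v ∅) φ with hX
  set d : ℝ := H (reach (Function.update φ v ⊤) n (insert v S ∪ X)) -
    H (reach (Function.update φ v ⊤) n (S ∪ X)) with hd
  have hpt : ∀ s, H (reach (Function.update φ v s) n (S ∪ triggered x (Function.update φ v s))) -
      H (reach (Function.update φ v s) n
        (S ∪ triggered (Function.update x v ∅) (Function.update φ v s))) =
      (x v).indicator (fun _ => d) s := by
    intro s
    have h0 := triggered_update_of_notMem (x := Function.update x v ∅) (φ := φ) (v := v) (s := s)
      (by simp)
    rw [Function.update_idem, ← hX] at h0
    by_cases hs : s ∈ x v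
    · have hs' : Function.update φ v s v ∈ activates v S := by simpa using hx hs
      have e : ∀ T, S ⊆ T →
          reach (Function.update φ v s) n T = reach (Function.update φ v ⊤) n T := fun T hT => by
        rw [← reach_update_top (Function.update φ v s) hs' hT, Function.update_idem]
      rw [Set.indicator_of_mem hs, h0, triggered_update_of_mem hs, ← hX,
        e _ Finset.subset_union_left, e _ Finset.subset_union_left, hd,
        Finset.union_insert, Finset.insert_union]
    · rw [Set.indicator_of_notMem hs, h0, triggered_update_of_notMem hs, ← hX, sub_self]
  simp only [hpt]
  rw [integral_indicator MeasurableSet.of_discrete, setIntegral_const, smul_eq_mul]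

theorem triggeredInfluence_update_sub (H : Finset V → ℝ) (n : ℕ) (μ : NodeLaws V)
    (x : ∀ v, Set (ActFn V v)) (v : V) (y : Set (ActFn V v)) (S : Finset V)
    (hx : x v ⊆ activates v S) (hy : y ⊆ activates v S) :
    triggeredInfluence H n μ (Function.update x v y) S - triggeredInfluence H n μ x S =
      ((μ v : Measure (ActFn V v)).real y - (μ v : Measure (ActFn V v)).real (x v)) *
        forcedGain H n μ x v S := by
  rw [triggeredInfluence_eq_add H n μ x v S hx,
    triggeredInfluence_eq_add H n μ (Function.update x v y) v S (by simpa using hy),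
    Function.update_idem, forcedGain_update, Function.update_self]
  ring

/-- Law of total probability for the event that `v` is triggered. -/
theorem triggeredInfluence_split (H : Finset V → ℝ) (n : ℕ) (μ : NodeLaws V)
    (x : ∀ v, Set (ActFn V v)) (v : V) (ν : ProbabilityMeasure (ActFn V v))
    (hν : (μ v : Measure (ActFn V v)).restrict (x v)ᶜ =
      (μ v : Measure (ActFn V v)) (x v)ᶜ • (ν : Measure (ActFn V v))) (S : Finset V) :
    triggeredInfluence H n μ x S =
      (μ v : Measure (ActFn V v)).real (x v) *
          triggeredInfluence H n (μ.force v) (Function.update x v ∅) (insert v S) +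
        (μ v : Measure (ActFn V v)).real (x v)ᶜ *
          triggeredInfluence H n (Function.update μ v ν) (Function.update x v ∅) S := by
  rw [triggeredInfluence_force, triggeredInfluence, triggeredInfluence, NodeLaws.joint,
    NodeLaws.joint, integral_pi_update, integral_pi_eq_integral_update μ v,
    ← integral_const_mul, ← integral_const_mul,
    ← integral_add Integrable.of_finite Integrable.of_finite]
  refine integral_congr_ae (.of_forall fun φ => ?_)
  set X := triggered (Function.update x v ∅) φ with hX
  beta_reduce
  rw [← integral_add_compl (s := x v) MeasurableSet.of_discrete Integrable.of_finite]
  congr 1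
  · rw [setIntegral_congr_fun (g := fun _ => H (reach (Function.update φ v ⊤) n (insert v S ∪ X)))
      MeasurableSet.of_discrete]
    · rw [setIntegral_const, smul_eq_mul]
    · intro s hs
      -- A seed remains active, so its own activation function is irrelevant.
      have hs' : Function.update φ v s v ∈ activates v {v} := fun h => absurd (by simp) h
      beta_reduce
      rw [triggered_update_of_mem hs, ← hX,
        ← reach_update_top (Function.update φ v s) hs' (by simp), Function.update_idem,
        Finset.union_insert, Finset.insert_union]
  · rw [setIntegral_congr_fun (g := fun s => H (reach (Function.update φ v s) n
      (S ∪ triggered (Function.update x v ∅) (Function.update φ v s)))) MeasurableSet.of_discrete]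
    · rw [hν, integral_smul_measure]
      rfl
    · intro s hs
      have h0 := triggered_update_of_notMem (x := Function.update x v ∅) (φ := φ) (v := v) (s := s)
        (by simp)
      rw [Function.update_idem, ← hX] at h0
      beta_reduce
      rw [triggered_update_of_notMem hs, h0]

end Influence

/-! ### Submodularity of the influence -/

section Submodularity

variable {V : Type*} [DecidableEq V]

/-- If `A` consists of activation functions that activate `v` from `S₀`, the distribution
conditioned on the complement of `A` still has submodular activation probabilities above `S₀`. -/
theorem exists_law_restrict_compl {v : V} {S₀ : Finset V} (ρ : ProbabilityMeasure (ActFn V v))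
    (hρ : SubmodularAbove S₀ fun S => (ρ : Measure (ActFn V v)).real (activates v S))
    {A : Set (ActFn V v)} (hA : A ⊆ activates v S₀) :
    ∃ ν : ProbabilityMeasure (ActFn V v),
      (ρ : Measure (ActFn V v)).restrict Aᶜ =
        (ρ : Measure (ActFn V v)) Aᶜ • (ν : Measure (ActFn V v)) ∧
      SubmodularAbove S₀ fun S => (ν : Measure (ActFn V v)).real (activates v S) := by
  by_cases h0 : (ρ : Measure (ActFn V v)) Aᶜ = 0
  · -- The complement is null, and any distribution will do.
    exact ⟨diracTop v, by rw [h0, zero_smul, Measure.restrict_eq_zero.2 h0],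
      submodularAbove_diracTop v S₀⟩
  · have hp := cond_isProbabilityMeasure h0
    refine ⟨(⟨ProbabilityTheory.cond (ρ : Measure (ActFn V v)) Aᶜ, hp⟩ :
      {ν : Measure (ActFn V v) // IsProbabilityMeasure ν}), ?_, fun S T hS hT => ?_⟩
    · change _ = _ • ProbabilityTheory.cond (ρ : Measure (ActFn V v)) Aᶜ
      rw [ProbabilityTheory.cond, smul_smul, ENNReal.mul_inv_cancel h0 (measure_ne_top _ _),
        one_smul]
    · change (ProbabilityTheory.cond (ρ : Measure (ActFn V v)) Aᶜ).real _ +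
          (ProbabilityTheory.cond (ρ : Measure (ActFn V v)) Aᶜ).real _ ≤
        (ProbabilityTheory.cond (ρ : Measure (ActFn V v)) Aᶜ).real _ +
          (ProbabilityTheory.cond (ρ : Measure (ActFn V v)) Aᶜ).real _
      have hsub : ∀ U, S₀ ⊆ U → A ⊆ activates v U := fun U hU => hA.trans (activates_mono v hU)
      rw [cond_compl_real_of_subset _ (hsub _ (hS.trans Finset.subset_union_left)),
        cond_compl_real_of_subset _ (hsub _ (Finset.subset_inter hS hT)),
        cond_compl_real_of_subset _ (hsub _ hS), cond_compl_real_of_subset _ (hsub _ hT),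
        ← mul_add, ← mul_add]
      refine mul_le_mul_of_nonneg_left ?_ (inv_nonneg.2 measureReal_nonneg)
      have := hρ S T hS hT
      beta_reduce at this
      linarith

theorem update_empty_subset {x y : ∀ v, Set (ActFn V v)} (h : ∀ v, x v ⊆ y v) (v u : V) :
    Function.update x v ∅ u ⊆ y u := by
  rcases eq_or_ne u v with rfl | hu
  · simp
  · simpa [hu] using h u

theorem piecewise_subset {x y z : ∀ v, Set (ActFn V v)} (hx : ∀ v, x v ⊆ z v)
    (hy : ∀ v, y v ⊆ z v) (W : Finset V) (v : V) : W.piecewise y x v ⊆ z v := by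
  by_cases h : v ∈ W
  · simpa [h] using hy v
  · simpa [h] using hx v

variable [Fintype V]

/-- The `n`-step influence functions are submodular whenever the activation probabilities are.  The
version relative to a base set `S₀` is needed because conditioning on not being activated by `S₀`
preserves submodularity of the activation probabilities only above `S₀`. -/
def InfluenceSubmodular (H : Finset V → ℝ) (n : ℕ) : Prop :=
  ∀ (μ : NodeLaws V) (S₀ : Finset V), μ.SubmodularAbove S₀ →
    SubmodularAbove S₀ (triggeredInfluence H n μ fun _ => ∅)

/-- Condition, one node at a time, on the triggered set: a triggered node becomes a seed, and the
activation function of any other node is conditioned on not being triggered. -/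
theorem InfluenceSubmodular.triggeredInfluence {H : Finset V → ℝ} {n : ℕ}
    (hP : InfluenceSubmodular H n) {μ : NodeLaws V} {S₀ : Finset V} (hμ : μ.SubmodularAbove S₀)
    {x : ∀ v, Set (ActFn V v)} (hx : ∀ v, x v ⊆ activates v S₀) :
    SubmodularAbove S₀ (triggeredInfluence H n μ x) := by
  suffices h : ∀ (W : Finset V) (μ : NodeLaws V), μ.SubmodularAbove S₀ →
      ∀ x : ∀ v, Set (ActFn V v), (∀ v, x v ⊆ activates v S₀) → (∀ v ∉ W, x v = ∅) →
      SubmodularAbove S₀ (_root_.triggeredInfluence H n μ x) from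
    h Finset.univ μ hμ x hx fun v hv => absurd (Finset.mem_univ v) hv
  intro W
  induction W using Finset.induction_on with
  | empty =>
    intro μ hμ x _ hW
    rw [show x = fun _ => ∅ from funext fun v => hW v (Finset.notMem_empty v)]
    exact hP μ S₀ hμ
  | insert v W _ ih =>
    intro μ hμ x hx hW A B hA hB
    obtain ⟨ν, hν, hνs⟩ := exists_law_restrict_compl (μ v) (hμ v) (hx v)
    have hx' : ∀ u, Function.update x v ∅ u ⊆ activates u S₀ := fun u => by
      rcases eq_or_ne u v with rfl | hu
      · simp
      · simpa [hu] using hx u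
    have hW' : ∀ u ∉ W, Function.update x v ∅ u = ∅ := fun u hu => by
      rcases eq_or_ne u v with rfl | huv
      · simp
      · simpa [huv] using hW u (by simp [huv, hu])
    have h1 := ih (μ.force v) (hμ.force v) _ hx' hW' (insert v A) (insert v B)
      (hA.trans (Finset.subset_insert v A)) (hB.trans (Finset.subset_insert v B))
    have h2 := ih (Function.update μ v ν) (hμ.update v ν hνs) _ hx' hW' A B hA hB
    rw [← Finset.insert_inter_distrib, ← Finset.insert_union_distrib] at h1
    simp only [triggeredInfluence_split H n μ x v ν hν]
    have h3 := mul_le_mul_of_nonneg_left h1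
      (measureReal_nonneg (μ := (μ v : Measure (ActFn V v))) (s := x v))
    have h4 := mul_le_mul_of_nonneg_left h2
      (measureReal_nonneg (μ := (μ v : Measure (ActFn V v))) (s := (x v)ᶜ))
    linarith

theorem forcedGain_anti_seeds {H : Finset V → ℝ} (hH : Monotone H) {n : ℕ}
    (hP : InfluenceSubmodular H n) {μ : NodeLaws V} {S T : Finset V} (hμ : μ.SubmodularAbove S)
    (hST : S ⊆ T) {x : ∀ v, Set (ActFn V v)} (hx : ∀ v, x v ⊆ activates v S) (v : V) :
    forcedGain H n μ x v T ≤ forcedGain H n μ x v S := by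
  have h := hP.triggeredInfluence (hμ.force v) (update_empty_subset hx v) (insert v S) T
    (Finset.subset_insert v S) hST
  have h1 : insert v S ∪ T = insert v T := by
    rw [Finset.insert_union, Finset.union_eq_right.2 hST]
  have h2 := triggeredInfluence_mono hH n (μ.force v) (Function.update x v ∅)
    (Finset.subset_inter (Finset.subset_insert v S) hST)
  rw [h1] at h
  unfold forcedGain
  linarith

/-- Forced gains decrease as the triggering probabilities grow: by
`triggeredInfluence_update_sub`, the effect of a change at another node `u` is proportional to a
difference of forced gains at `u` for two nested seed sets. -/
theorem forcedGain_anti_trigger {H : Finset V → ℝ} (hH : Monotone H) {n : ℕ}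
    (hP : InfluenceSubmodular H n) {μ : NodeLaws V} {S : Finset V} (hμ : μ.SubmodularAbove S)
    {x y : ∀ v, Set (ActFn V v)} (hx : ∀ v, x v ⊆ activates v S)
    (hy : ∀ v, y v ⊆ activates v S)
    (hxy : ∀ v, (μ v : Measure (ActFn V v)).real (x v) ≤ (μ v : Measure (ActFn V v)).real (y v))
    (v : V) : forcedGain H n μ y v S ≤ forcedGain H n μ x v S := by
  suffices h : ∀ W : Finset V, forcedGain H n μ (W.piecewise y x) v S ≤ forcedGain H n μ x v S by
    simpa using h Finset.univ
  intro W
  induction W using Finset.induction_on with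
  | empty => simp
  | insert u W hu ih =>
    refine le_trans ?_ ih
    rw [Finset.piecewise_insert]
    have hz := piecewise_subset hx hy W
    set z := W.piecewise y x with hzdef
    rcases eq_or_ne u v with rfl | huv
    · rw [forcedGain_update]
    · have hz' := update_empty_subset hz v
      have hle := forcedGain_anti_seeds hH hP (hμ.force v) (Finset.subset_insert v S) hz' u
      have e1 := triggeredInfluence_update_sub H n (μ.force v) (Function.update z v ∅) u (y u)
        (insert v S) ((hz' u).trans (activates_mono u (Finset.subset_insert v S)))
        ((hy u).trans (activates_mono u (Finset.subset_insert v S)))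
      have e2 := triggeredInfluence_update_sub H n (μ.force v) (Function.update z v ∅) u (y u)
        S (hz' u) (hy u)
      have hzu : z u = x u := by simp [hzdef, hu]
      rw [NodeLaws.force_of_ne μ huv, Function.update_of_ne huv, hzu] at e1 e2
      have hmul := mul_le_mul_of_nonneg_left hle (sub_nonneg.2 (hxy u))
      unfold forcedGain at *
      rw [Function.update_comm huv] at *
      linarith

/-- Increasing the triggering probabilities has diminishing returns, both in the seeds and in
the triggering probabilities that one starts from. -/
theorem triggeredInfluence_sub_le {H : Finset V → ℝ} (hH : Monotone H) {n : ℕ}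
    (hP : InfluenceSubmodular H n) {μ : NodeLaws V} {S T : Finset V} (hμ : μ.SubmodularAbove S)
    (hST : S ⊆ T) {x y x' y' : ∀ v, Set (ActFn V v)}
    (hx : ∀ v, x v ⊆ activates v S) (hy : ∀ v, y v ⊆ activates v S)
    (hx' : ∀ v, x' v ⊆ activates v T) (hy' : ∀ v, y' v ⊆ activates v T)
    (hxx : ∀ v, (μ v : Measure (ActFn V v)).real (x v) ≤ (μ v : Measure (ActFn V v)).real (x' v))
    (hyy : ∀ v, (μ v : Measure (ActFn V v)).real (y v) ≤ (μ v : Measure (ActFn V v)).real (y' v))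
    (hxy' : ∀ v,
      (μ v : Measure (ActFn V v)).real (x' v) ≤ (μ v : Measure (ActFn V v)).real (y' v))
    (hsub : ∀ v,
      (μ v : Measure (ActFn V v)).real (y' v) - (μ v : Measure (ActFn V v)).real (x' v) ≤
        (μ v : Measure (ActFn V v)).real (y v) - (μ v : Measure (ActFn V v)).real (x v)) :
    triggeredInfluence H n μ y' T - triggeredInfluence H n μ x' T ≤
      triggeredInfluence H n μ y S - triggeredInfluence H n μ x S := by
  suffices h : ∀ W : Finset V,
      triggeredInfluence H n μ (W.piecewise y' x') T - triggeredInfluence H n μ x' T ≤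
        triggeredInfluence H n μ (W.piecewise y x) S - triggeredInfluence H n μ x S by
    simpa using h Finset.univ
  intro W
  induction W using Finset.induction_on with
  | empty => simp
  | insert v W hv ih =>
    rw [Finset.piecewise_insert, Finset.piecewise_insert]
    have hz := piecewise_subset hx hy W
    have hz' := piecewise_subset hx' hy' W
    have hzz : ∀ u, (μ u : Measure (ActFn V u)).real (W.piecewise y x u) ≤
        (μ u : Measure (ActFn V u)).real (W.piecewise y' x' u) := fun u => by
      by_cases h : u ∈ W
      · simpa [h] using hyy u
      · simpa [h] using hxx u
    have hzv : W.piecewise y x v = x v := by simp [hv]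
    have hzv' : W.piecewise y' x' v = x' v := by simp [hv]
    set z := W.piecewise y x
    set z' := W.piecewise y' x'
    have e1 := triggeredInfluence_update_sub H n μ z v (y v) S (hz v) (hy v)
    have e2 := triggeredInfluence_update_sub H n μ z' v (y' v) T (hz' v) (hy' v)
    rw [hzv] at e1
    rw [hzv'] at e2
    have hgain : forcedGain H n μ z' v T ≤ forcedGain H n μ z v S :=
      (forcedGain_anti_trigger hH hP (hμ.mono hST)
        (fun u => (hz u).trans (activates_mono u hST)) hz' hzz v).trans
        (forcedGain_anti_seeds hH hP hμ hST hz v)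
    have hmul := mul_le_mul (hsub v) hgain (forcedGain_nonneg hH n μ z' v T)
      ((sub_nonneg.2 (hxy' v)).trans (hsub v))
    linarith

/-- The influence of independent activation functions with submodular activation probabilities is
submodular, for every step limit. -/
theorem influenceSubmodular {H : Finset V → ℝ} (hH : Monotone H) (hsub : IsSubmodular H) (n : ℕ) :
    InfluenceSubmodular H n := by
  induction n with
  | zero =>
    intro μ S₀ _ A B _ _
    have h : ∀ S, triggeredInfluence H 0 μ (fun _ => ∅) S = H S := fun S => by
      rw [triggeredInfluence_empty]
      simp [reach]
    simpa only [h] using hsub A B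
  | succ n ih =>
    intro μ S₀ hμ A B hA hB
    have hμ' : μ.SubmodularAbove (A ∩ B) := hμ.mono (Finset.subset_inter hA hB)
    have hm : ∀ {S T : Finset V}, S ⊆ T → ∀ v, (μ v : Measure (ActFn V v)).real (activates v S) ≤
        (μ v : Measure (ActFn V v)).real (activates v T) := fun h v =>
      measureReal_mono (activates_mono v h)
    have hAB : A ∩ B ⊆ A := Finset.inter_subset_left
    have hBA : A ∩ B ⊆ B := Finset.inter_subset_right
    have hA' : A ⊆ A ∪ B := Finset.subset_union_left
    have hB' : B ⊆ A ∪ B := Finset.subset_union_right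
    simp only [← triggeredInfluence_activates]
    -- raise the triggering sets from those of `A` to those of `A ∪ B`, with seeds `A ∪ B`
    have h1 := triggeredInfluence_sub_le hH ih (hμ'.mono hBA) hB'
      (x := fun v => activates v (A ∩ B)) (y := fun v => activates v B)
      (x' := fun v => activates v A) (y' := fun v => activates v (A ∪ B))
      (fun v => activates_mono v hBA) (fun _ => subset_rfl)
      (fun v => activates_mono v hA') (fun _ => subset_rfl)
      (hm hAB) (hm hB') (hm hA') (fun v => by
        have := hμ v A B hA hB
        beta_reduce at this
        linarith)
    -- raise the triggering sets from those of `A ∩ B` to those of `A`, with the same seeds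
    have h2 := triggeredInfluence_sub_le hH ih (hμ'.mono hAB) hA'
      (x := fun v => activates v (A ∩ B)) (y := fun v => activates v A)
      (x' := fun v => activates v (A ∩ B)) (y' := fun v => activates v A)
      (fun v => activates_mono v hAB) (fun _ => subset_rfl)
      (fun v => activates_mono v (hAB.trans hA')) (fun v => activates_mono v hA')
      (fun _ => le_rfl) (fun _ => le_rfl) (hm hAB) (fun _ => le_rfl)
    -- keep the triggering sets of `A ∩ B`, and change only the seeds
    have h3 := ih.triggeredInfluence hμ' (x := fun v => activates v (A ∩ B))
      (fun _ => subset_rfl) A B hAB hBA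
    linarith

end Submodularity

/-! ### Strong submodularity of independent models -/

section IndependentModels

variable {V : Type*} [DecidableEq V]

theorem liftUnion_union (T : Finset V) (A B : Finset {v : V // v ∉ T}) :
    liftUnion T (A ∪ B) = liftUnion T A ∪ liftUnion T B := by
  rw [liftUnion, liftUnion, liftUnion, Finset.map_union, Finset.union_union_distrib_right]

theorem liftUnion_inter (T : Finset V) (A B : Finset {v : V // v ∉ T}) :
    liftUnion T (A ∩ B) = liftUnion T A ∩ liftUnion T B := by
  rw [liftUnion, liftUnion, liftUnion, Finset.map_inter, Finset.inter_union_distrib_right]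

theorem IsSubmodular.reduce {H : Utility V} (hH : IsSubmodular H.toFun) (T : Finset V) :
    IsSubmodular (H.reduce T).toFun := fun A B => by
  have h := hH (liftUnion T A) (liftUnion T B)
  rw [← liftUnion_union, ← liftUnion_inter] at h
  change H.toFun _ - H.toFun T + (H.toFun _ - H.toFun T) ≤
    H.toFun _ - H.toFun T + (H.toFun _ - H.toFun T)
  linarith

theorem reduce_preimage_activates (T : Finset V) (v : {v : V // v ∉ T})
    (S : Finset {v : V // v ∉ T}) :
    ActFn.reduce T v ⁻¹' activates v S = activates v.1 (liftUnion T S) := by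
  ext g
  refine ⟨fun h hv => h fun hS => hv ?_, fun h hv => h (notMem_liftUnion hv)⟩
  exact Finset.mem_union_left _ (Finset.mem_map_of_mem _ hS)

theorem SDM.reducedNodeLaw_real_activates [Fintype V] (G : SDM V) (T : Finset V)
    (v : {v : V // v ∉ T}) (S : Finset {v : V // v ∉ T}) :
    (G.reducedNodeLaw T v).real (activates v S) =
      ((G.nodeLaw v.1).real (activates v.1 T)ᶜ)⁻¹ *
        ((G.nodeLaw v.1).real (activates v.1 (liftUnion T S)) -
          (G.nodeLaw v.1).real (activates v.1 T)) := by
  have := G.isProb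
  have : IsProbabilityMeasure (G.nodeLaw v.1) :=
    Measure.isProbabilityMeasure_map (measurable_pi_apply v.1).aemeasurable
  have hsub : activates v.1 T ⊆ activates v.1 (liftUnion T S) :=
    activates_mono v.1 Finset.subset_union_right
  have hset : {g : ActFn V v.1 | g ⟨T, v.2⟩ = false} = (activates v.1 T)ᶜ := by
    ext g
    simp [activates, v.2]
  rw [SDM.reducedNodeLaw, map_measureReal_apply Measurable.of_discrete MeasurableSet.of_discrete,
    reduce_preimage_activates, hset,
    cond_compl_real_of_subset _ hsub]

/-- An independent model is strongly submodular as soon as its utility and the activation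
probabilities of its nodes are submodular. -/
theorem SDM.stronglySubmodular_of_nodeLaw [Fintype V] (G : SDM V) (hG : G.Independent)
    (hH : IsSubmodular G.utility.toFun)
    (hF : ∀ v, IsSubmodular fun S => (G.nodeLaw v).real (activates v S)) :
    G.StronglySubmodular := by
  refine ⟨hG, hH, fun T hT τ A B => ?_⟩
  let μ : NodeLaws {v : V // v ∉ T} := fun v =>
    (⟨G.reducedNodeLaw T v, G.reducedNodeLaw_isProb T hT v⟩ :
      {ν : Measure (ActFn {v : V // v ∉ T} v) // IsProbabilityMeasure ν})
  have hμ : μ.SubmodularAbove ∅ := fun v S S' _ _ => by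
    change (G.reducedNodeLaw T v).real _ + (G.reducedNodeLaw T v).real _ ≤
      (G.reducedNodeLaw T v).real _ + (G.reducedNodeLaw T v).real _
    simp only [G.reducedNodeLaw_real_activates, ← mul_add]
    refine mul_le_mul_of_nonneg_left ?_ (inv_nonneg.2 measureReal_nonneg)
    have h := hF v.1 (liftUnion T S) (liftUnion T S')
    rw [← liftUnion_union, ← liftUnion_inter] at h
    beta_reduce at h
    linarith
  have h := influenceSubmodular (G.utility.reduce T).mono (hH.reduce T) τ μ ∅ hμ A B
    (Finset.empty_subset A) (Finset.empty_subset B)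
  simp only [triggeredInfluence_empty] at h
  exact h

/-! ### Independent cascade and independent threshold models -/

theorem iIndepFun_map {Ω Ω' ι : Type*} [MeasurableSpace Ω] [MeasurableSpace Ω'] [Fintype ι]
    {β : ι → Type*} [∀ i, MeasurableSpace (β i)] {P : Measure Ω} [IsProbabilityMeasure P]
    {g : Ω → Ω'} (hg : Measurable g) {f : ∀ i, Ω' → β i} (hf : ∀ i, Measurable (f i))
    (h : iIndepFun (fun i ω => f i (g ω)) P) : iIndepFun f (P.map g) := by
  have := Measure.isProbabilityMeasure_map (μ := P) hg.aemeasurable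
  rw [iIndepFun_iff_map_fun_eq_pi_map fun i => (hf i).aemeasurable,
    Measure.map_map (measurable_pi_lambda _ hf) hg]
  simp only [Measure.map_map (hf _) hg]
  exact h.map_fun_eq_pi_map fun i => ((hf i).comp hg).aemeasurable

/-- Sampling a product measure independently for each `k : κ`, and reading off the coordinate `i`
from the sample of `t i`, gives the same product measure again. -/
theorem map_pi_pi_diagonal {ι κ : Type*} [Fintype ι] [Fintype κ] [DecidableEq κ] {α : ι → Type*}
    [∀ i, MeasurableSpace (α i)] (m : ∀ i, Measure (α i)) [∀ i, IsProbabilityMeasure (m i)]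
    (t : ι → κ) :
    (Measure.pi fun _ : κ => Measure.pi m).map (fun ω i => ω (t i) i) = Measure.pi m := by
  refine (Measure.pi_eq fun s hs => ?_).symm
  have hm : Measurable fun (ω : κ → ∀ i, α i) i => ω (t i) i :=
    measurable_pi_lambda _ fun i => (measurable_pi_apply i).comp (measurable_pi_apply (t i))
  have hpre : (fun (ω : κ → ∀ i, α i) i => ω (t i) i) ⁻¹' Set.univ.pi s =
      Set.univ.pi fun k => Set.univ.pi fun i => if t i = k then s i else Set.univ := by
    ext ω
    simp only [Set.mem_preimage, Set.mem_univ_pi]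
    constructor
    · intro h k i
      split_ifs with hk
      · exact hk ▸ h i
      · trivial
    · intro h i
      simpa using h (t i) i
  have hterm : ∀ k i, m i (if t i = k then s i else Set.univ) =
      if t i = k then m i (s i) else 1 := fun k i => by
    split_ifs <;> simp
  rw [Measure.map_apply hm (MeasurableSet.univ_pi hs), hpre, Measure.pi_pi]
  simp only [Measure.pi_pi, hterm]
  rw [Finset.prod_comm]
  simp

/-- The measure of a family of events that turns unions into unions is submodular. -/
theorem isSubmodular_measureReal {Ω : Type*} [MeasurableSpace Ω] (P : Measure Ω)
    [IsFiniteMeasure P] {C : Finset V → Set Ω} (hC : ∀ S, MeasurableSet (C S))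
    (hmono : Monotone C) (hunion : ∀ A B, C (A ∪ B) ⊆ C A ∪ C B) :
    IsSubmodular fun S => P.real (C S) := fun A B => by
  have h1 := measureReal_union_add_inter (μ := P) (s := C A) (hC B)
  have h2 : P.real (C (A ∪ B)) ≤ P.real (C A ∪ C B) := measureReal_mono (hunion A B)
  have h3 : P.real (C (A ∩ B)) ≤ P.real (C A ∩ C B) := measureReal_mono
    (Set.subset_inter (hmono Finset.inter_subset_left) (hmono Finset.inter_subset_right))
  beta_reduce
  linarith

theorem independentCascade_independent [Fintype V] (E : Finset (V × V)) (p : E → unitInterval)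
    (H : Utility V) : (SDM.independentCascade E p H).Independent := by
  refine iIndepFun_map Measurable.of_discrete (fun v => measurable_pi_apply v) ?_
  -- Draw all edges afresh for each node, and let an edge use the draw made for its target.
  rw [← map_pi_pi_diagonal (fun e => bernoulliMeasure true false (p e)) fun e : E => e.1.2]
  refine iIndepFun_map Measurable.of_discrete (fun v => Measurable.of_discrete) ?_
  have h : (fun (v : V) (ω : V → E → Bool) => liveEdgeAct E (fun e => ω e.1.2 e) v) =
      fun v ω => liveEdgeAct E (ω v) v := by
    funext v ω
    ext S
    refine decide_eq_decide.2 (exists_congr fun e => and_congr_right fun _ => ?_)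
    refine and_congr_right fun he => ?_
    beta_reduce
    rw [he]
  rw [h]
  exact iIndepFun_pi (X := fun v ω => liveEdgeAct E ω v)
    fun v => Measurable.of_discrete.aemeasurable

/-- Already for every fixed set of live edges, the activation of `v` is a union over the seeds. -/
theorem independentCascade_nodeLaw_submodular [Fintype V] (E : Finset (V × V))
    (p : E → unitInterval) (H : Utility V) (v : V) :
    IsSubmodular fun S =>
      ((SDM.independentCascade E p H).nodeLaw v).real (activates v S) := by
  have h : ∀ S, ((SDM.independentCascade E p H).nodeLaw v).real (activates v S) =
      (Measure.pi fun e => bernoulliMeasure true false (p e)).real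
        {ω | liveEdgeAct E ω v ∈ activates v S} := fun S => by
    rw [SDM.nodeLaw, SDM.independentCascade, SDM.liveEdge, Measure.map_map Measurable.of_discrete
      Measurable.of_discrete, map_measureReal_apply Measurable.of_discrete
      MeasurableSet.of_discrete]
    rfl
  simp only [h]
  refine isSubmodular_measureReal _ (fun _ => MeasurableSet.of_discrete)
    (fun S T hST ω hω => activates_mono v hST hω) fun A B ω hω => ?_
  by_cases hA : v ∈ A
  · exact Or.inl fun h => absurd hA h
  by_cases hB : v ∈ B
  · exact Or.inr fun h => absurd hB h
  have hAB : v ∉ A ∪ B := by simp [hA, hB]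
  obtain ⟨e, he, he'⟩ := of_decide_eq_true (hω hAB)
  rcases Finset.mem_union.1 he with he | he
  · exact Or.inl fun _ => decide_eq_true ⟨e, he, he'⟩
  · exact Or.inr fun _ => decide_eq_true ⟨e, he, he'⟩

theorem independentThreshold_independent {V : Type*} [Fintype V] (F : ThresholdFamily V)
    (H : Utility V) :
    (SDM.independentThreshold F H).Independent := by
  refine iIndepFun_map (measurable_thresholdAct F) (fun v => measurable_pi_apply v) ?_
  exact iIndepFun_pi (X := fun v t => thresholdAct F (fun _ => t) v) fun v =>
    ((measurable_pi_apply v).comp ((measurable_thresholdAct F).comp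
      (measurable_pi_lambda _ fun _ => measurable_id))).aemeasurable

theorem independentThreshold_nodeLaw_real [Fintype V] (F : ThresholdFamily V) (H : Utility V)
    (v : V) (S : Finset V) :
    ((SDM.independentThreshold F H).nodeLaw v).real (activates v S) =
      if v ∈ S then 1 else F.f v S := by
  have hm : Measurable fun θ => thresholdAct F θ v :=
    (measurable_pi_apply v).comp (measurable_thresholdAct F)
  have h : (SDM.independentThreshold F H).nodeLaw v =
      (Measure.pi fun _ : V => (volume : Measure unitInterval)).map fun θ => thresholdAct F θ v :=
    Measure.map_map (measurable_pi_apply v) (measurable_thresholdAct F)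
  rw [h, map_measureReal_apply hm MeasurableSet.of_discrete]
  split_ifs with hv
  · have hset : (fun θ => thresholdAct F θ v) ⁻¹' activates v S = Set.univ :=
      Set.eq_univ_of_forall fun θ h => absurd hv h
    rw [hset, probReal_univ]
  · have hset : (fun θ => thresholdAct F θ v) ⁻¹' activates v S =
        Function.eval v ⁻¹' Set.Iic (⟨F.f v S, F.mem_Icc v S⟩ : unitInterval) := by
      ext θ
      exact ⟨fun h => of_decide_eq_true (p := (θ v : ℝ) ≤ F.f v S) (h hv),
        fun h _ => decide_eq_true (p := (θ v : ℝ) ≤ F.f v S) h⟩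
    rw [hset, measureReal_def, (measurePreserving_eval _ v).measure_preimage
      measurableSet_Iic.nullMeasurableSet, unitInterval.volume_Iic,
      ENNReal.toReal_ofReal (F.mem_Icc v S).1]

theorem independentThreshold_nodeLaw_submodular [Fintype V] (F : ThresholdFamily V)
    (H : Utility V) (v : V) (hF : IsSubmodular (F.f v)) :
    IsSubmodular fun S =>
      ((SDM.independentThreshold F H).nodeLaw v).real (activates v S) := fun A B => by
  simp only [independentThreshold_nodeLaw_real]
  have h := hF A B
  have hA := F.mono v (Finset.inter_subset_left (s₁ := A) (s₂ := B))
  have hB := F.mono v (Finset.inter_subset_right (s₁ := A) (s₂ := B))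
  by_cases h1 : v ∈ A <;> by_cases h2 : v ∈ B <;> simp [h1, h2] <;> linarith

end IndependentModels

theorem mainTheorem5 {V : Type*} [Fintype V] [DecidableEq V] (H : Utility V)
    (hH : IsSubmodular H.toFun) :
    (∀ (E : Finset (V × V)) (p : E → unitInterval),
      (SDM.independentCascade E p H).StronglySubmodular) ∧
    (∀ F : ThresholdFamily V, (∀ v, IsSubmodular (F.f v)) →
      (SDM.independentThreshold F H).StronglySubmodular) :=
  ⟨fun E p => SDM.stronglySubmodular_of_nodeLaw _ (independentCascade_independent E p H) hH
      (independentCascade_nodeLaw_submodular E p H),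
    fun F hF => SDM.stronglySubmodular_of_nodeLaw _ (independentThreshold_independent F H) hH
      fun v => independentThreshold_nodeLaw_submodular F H v (hF v)⟩
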